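/- Let $R\in\mathrm{Mat}_d(\{0,1\})$ and let $M\ge 1$ be such that all entries of $R^M$ are positive. Let $\Sigma=\{x\in\{1,\dots,d\}^{\mathbb N}: R(x_n,x_{n+1})=1\ \forall n\}$ be the corresponding (mixing) one-sided subshift of finite type, with shift $\tau$, and let $\mathscr W$ be the set of finite allowed words (initial segments of points of $\Sigma$), including the empty word. Let $\nu$ be a $\tau$-invariant Borel probability measure on $\Sigma$ of full support. Write $S_n\varphi=\sum_{k=0}^{n-1}\varphi\circ\tau^k$. A function $L:\mathscr W\to\mathbb R$ is a *quasimorphism* if $\|\delta L\|=\sup|L(ab)-L(a)-L(b)|<\infty$, the supremum being over all pairs $a,b\in\mathscr W$ with $ab\in\mathscr W$. The space $\mathrm{QM}(\mathscr W)$ of quasimorphisms carries the norm $\|L\|=\max_{|a|\le M}|L(a)|+\|\delta L\|$, and $\widetilde{\mathrm{QM}}(\mathscr W)=\mathrm{QM}(\mathscr W)/\ell^\infty(\mathscr W)$ carries the quotient norm. A class in $L^\infty(\nu)$ is a *$\nu$-weak Bowen function* if it is represented by a bounded function $\varphi$ on a dense set $D$ of full $\nu$-measure with $\tau(D)\subset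 D$ for which there is $C>0$ such that $|S_n\varphi(x)-S_n\varphi(y)|\le C$ for all $n\ge1$ and all $x,y\in D$ with $x_i=y_i$ for $0\le i<n$. The space $\mathrm{Bow}_\nu(\Sigma)$ of such classes carries the norm $\|\varphi\|_B+\|\varphi\|_{L^\infty(\nu)}$, where $\|\varphi\|_B$ is the infimum of the admissible $C$ (over all representatives). Let $\mathrm{Cob}_\nu=\{u-u\circ\tau: u\in L^\infty(\nu)\}\subset L^\infty(\nu)$. Then $\mathrm{Cob}_\nu\subset\mathrm{Bow}_\nu(\Sigma)$, the quotients $\widetilde{\mathrm{QM}}(\mathscr W)$ and $\mathrm{Bow}_\nu(\Sigma)/\mathrm{Cob}_\nu$ are Banach spaces for their quotient norms, and there is a linear homeomorphism $$\Gamma:\widetilde{\mathrm{QM}}(\mathscr W)\to \mathrm{Bow}_\nu(\Sigma)/\mathrm{Cob}_\nu$$ such that, for $L\in\mathrm{QM}(\mathscr W)$ and $\varphi\in\mathrm{Bow}_\nu(\Sigma)$, one has $\Gamma([L])=[\varphi]$ if and only if there is a constant $E$ with $$|L(x_0\cdots x_{n-1})-S_n\varphi(x)|<E\qquad\text{for all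 } n\ge1\text{ and } \nu\text{-a.e. }x\in\Sigma .$$ In particular every quasimorphism $L$ has an associated potential $\varphi_L\in\mathrm{Bow}_\nu(\Sigma)$ satisfying this bound, and $\Gamma([L])=[\varphi_L]$. -/

import Mathlib

open MeasureTheory Filter Topology
open scoped ENNReal

noncomputable section

namespace WeakBowen

/-- The one-sided subshift of finite type determined by the transition matrix `R`, with the
topology (and Borel sigma-algebra) induced by the product of discrete spaces. -/
abbrev SFT {d : ℕ} (R : Matrix (Fin d) (Fin d) ℕ) : Type :=
  {x : ℕ → Fin d // ∀ n, R (x n) (x (n + 1)) = 1}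

variable {d : ℕ} (R : Matrix (Fin d) (Fin d) ℕ)

/-- The shift map. -/
def shift (x : SFT R) : SFT R := ⟨fun n => x.1 (n + 1), fun n => x.2 (n + 1)⟩

/-- The finite words `a` that are empty or an initial segment of a point of the subshift. -/
def IsWord (a : List (Fin d)) : Prop :=
  a = [] ∨ ∃ x : SFT R, ∀ (i : ℕ) (h : i < a.length), a[i] = x.1 i

/-- The set of finite allowed words (including the empty word). -/
abbrev Word : Type := {a : List (Fin d) // IsWord R a}

/-- The word `x₀ ⋯ xₙ₋₁`. -/
def initialWord (x : SFT R) (n : ℕ) : Word R :=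
  ⟨List.ofFn fun i : Fin n => x.1 i, Or.inr ⟨x, fun i h => by simp⟩⟩

/-- The pairs of words whose concatenation is an allowed word. -/
abbrev ConcatPair : Type := {p : Word R × Word R // IsWord R (p.1.1 ++ p.2.1)}

/-- `δL(a, b) = L(ab) - L(a) - L(b)`. -/
def delta (L : Word R → ℝ) (p : ConcatPair R) : ℝ :=
  L ⟨p.1.1.1 ++ p.1.2.1, p.2⟩ - L p.1.1 - L p.1.2

/-- `L` is a quasimorphism if its defect is finite. -/
def IsQuasimorphism (L : Word R → ℝ) : Prop := ∃ C : ℝ, ∀ p, |delta R L p| ≤ C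

/-- The defect `‖δL‖` (a genuine supremum if `L` is a quasimorphism). -/
def defect (L : Word R → ℝ) : ℝ := ⨆ p : ConcatPair R, |delta R L p|

/-- The supremum of `|L|` over the (finitely many) words of length at most `M`. -/
def shortSup (M : ℕ) (L : Word R → ℝ) : ℝ := ⨆ a : {a : Word R // a.1.length ≤ M}, |L a.1|

def emptyWord : Word R := ⟨[], Or.inl rfl⟩

instance : Nonempty (ConcatPair R) := ⟨⟨(emptyWord R, emptyWord R), Or.inl rfl⟩⟩

instance (M : ℕ) : Nonempty {a : Word R // a.1.length ≤ M} := ⟨⟨emptyWord R, by simp [emptyWord]⟩⟩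

instance (M : ℕ) : Finite {a : Word R // a.1.length ≤ M} := by
  have h : Finite {l : List (Fin d) // l.length ≤ M} := (List.finite_length_le (Fin d) M).to_subtype
  refine Finite.of_injective
    (fun a : {a : Word R // a.1.length ≤ M} =>
      (⟨a.1.1, a.2⟩ : {l : List (Fin d) // l.length ≤ M})) ?_
  intro a b hab
  exact Subtype.ext (Subtype.ext (Subtype.mk.inj hab))

lemma delta_add (L L' : Word R → ℝ) (p : ConcatPair R) :
    delta R (L + L') p = delta R L p + delta R L' p := by
  simp only [delta, Pi.add_apply]; ring

lemma delta_smul (c : ℝ) (L : Word R → ℝ) (p : ConcatPair R) :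
    delta R (c • L) p = c * delta R L p := by
  simp only [delta, Pi.smul_apply, smul_eq_mul]; ring

/-- The quasimorphisms form a linear subspace of all functions on words. -/
def quasimorphisms : Submodule ℝ (Word R → ℝ) where
  carrier := {L | IsQuasimorphism R L}
  zero_mem' := ⟨0, fun p => by simp [delta]⟩
  add_mem' := by
    rintro L L' ⟨C, hC⟩ ⟨C', hC'⟩
    refine ⟨C + C', fun p => ?_⟩
    rw [delta_add]
    exact (abs_add_le _ _).trans (add_le_add (hC p) (hC' p))
  smul_mem' := by
    rintro c L ⟨C, hC⟩
    refine ⟨|c| * C, fun p => ?_⟩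
    rw [delta_smul, abs_mul]
    exact mul_le_mul_of_nonneg_left (hC p) (abs_nonneg c)

/-- The vector space of quasimorphisms, as a type of its own: it carries the norm
`‖L‖ = sup {|L a| : |a| ≤ M} + ‖δL‖`, which involves the specification constant `M`. -/
def QM (_M : ℕ) : Type := quasimorphisms R

instance (M : ℕ) : AddCommGroup (QM R M) := inferInstanceAs (AddCommGroup (quasimorphisms R))

instance (M : ℕ) : Module ℝ (QM R M) := inferInstanceAs (Module ℝ (quasimorphisms R))

instance (M : ℕ) : CoeFun (QM R M) (fun _ => Word R → ℝ) := ⟨fun L => L.1⟩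

instance (M : ℕ) : Norm (QM R M) := ⟨fun L => shortSup R M L + defect R L⟩

lemma bddAbove_delta {M : ℕ} (L : QM R M) : BddAbove (Set.range fun p => |delta R L p|) := by
  obtain ⟨C, hC⟩ := L.2
  exact ⟨C, by rintro _ ⟨p, rfl⟩; exact hC p⟩

lemma shortSup_add_le (M : ℕ) (L L' : Word R → ℝ) :
    shortSup R M (L + L') ≤ shortSup R M L + shortSup R M L' :=
  ciSup_le fun a => (abs_add_le _ _).trans
    (add_le_add (le_ciSup (f := fun a : {a : Word R // a.1.length ≤ M} => |L a.1|)
        (Set.finite_range _).bddAbove a)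
      (le_ciSup (f := fun a : {a : Word R // a.1.length ≤ M} => |L' a.1|)
        (Set.finite_range _).bddAbove a))

lemma shortSup_smul (M : ℕ) (c : ℝ) (L : Word R → ℝ) :
    shortSup R M (c • L) = |c| * shortSup R M L := by
  simp only [shortSup, Pi.smul_apply, smul_eq_mul, abs_mul]
  exact (Real.mul_iSup_of_nonneg (abs_nonneg c) _).symm

lemma defect_smul (c : ℝ) (L : Word R → ℝ) : defect R (c • L) = |c| * defect R L := by
  simp only [defect, delta_smul, abs_mul]
  exact (Real.mul_iSup_of_nonneg (abs_nonneg c) _).symm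

lemma defect_add_le {M : ℕ} (L L' : QM R M) :
    defect R ((L + L' : QM R M) : Word R → ℝ) ≤ defect R L + defect R L' :=
  ciSup_le fun p => by
    have h : delta R ((L + L' : QM R M) : Word R → ℝ) p = delta R L p + delta R L' p :=
      delta_add R L L' p
    rw [h]
    exact (abs_add_le _ _).trans
      (add_le_add (le_ciSup (bddAbove_delta R L) p) (le_ciSup (bddAbove_delta R L') p))

lemma QM.norm_smul_eq {M : ℕ} (c : ℝ) (L : QM R M) : ‖c • L‖ = |c| * ‖L‖ := by
  change shortSup R M (c • (L : Word R → ℝ)) + defect R (c • (L : Word R → ℝ)) = _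
  rw [shortSup_smul, defect_smul, ← mul_add]
  rfl

instance (M : ℕ) : SeminormedAddCommGroup (QM R M) :=
  AddGroupSeminorm.toSeminormedAddCommGroup
    { toFun := fun L => ‖L‖
      map_zero' := by simpa using QM.norm_smul_eq R (0 : ℝ) (0 : QM R M)
      add_le' := fun L L' => by
        have h₁ := shortSup_add_le R M L L'
        have h₂ := defect_add_le R L L'
        change shortSup R M ((L : Word R → ℝ) + (L' : Word R → ℝ)) + _ ≤
          (shortSup R M L + defect R L) + (shortSup R M L' + defect R L')
        linarith
      neg' := fun L => by simpa using QM.norm_smul_eq R (-1 : ℝ) L }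

instance (M : ℕ) : NormedSpace ℝ (QM R M) where
  norm_smul_le c L := (QM.norm_smul_eq R c L).le

/-- The cohomologically trivial quasimorphisms, that is, the bounded functions on words. -/
def boundedQM (M : ℕ) : Submodule ℝ (QM R M) where
  carrier := {L | ∃ C : ℝ, ∀ a, |L a| ≤ C}
  zero_mem' := ⟨0, fun a => by
    change |(0 : ℝ)| ≤ 0
    simp⟩
  add_mem' := by
    rintro L L' ⟨C, hC⟩ ⟨C', hC'⟩
    exact ⟨C + C', fun a => (abs_add_le (L a) (L' a)).trans (add_le_add (hC a) (hC' a))⟩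
  smul_mem' := by
    rintro c L ⟨C, hC⟩
    refine ⟨|c| * C, fun a => ?_⟩
    change |c * L a| ≤ _
    rw [abs_mul]
    exact mul_le_mul_of_nonneg_left (hC a) (abs_nonneg c)

/-- Quasimorphisms modulo bounded functions, with the quotient norm
`‖[L]‖ = inf {‖L'‖ : L' ∼ L}`. -/
abbrev QMQuot (M : ℕ) : Type := QM R M ⧸ boundedQM R M

/-- `f`, regarded as a function on `D`, is a weak Bowen function, with constant `C` in the Bowen
condition. The values of `f` off the forward invariant set `D` play no role. -/
structure IsWeakBowen (D : Set (SFT R)) (f : SFT R → ℝ) (C : ℝ) : Prop where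
  dense : Dense D
  invariant : Set.MapsTo (shift R) D D
  bounded : ∃ K : ℝ, ∀ x ∈ D, |f x| ≤ K
  pos : 0 < C
  bowen : ∀ n : ℕ, 1 ≤ n → ∀ x ∈ D, ∀ y ∈ D, (∀ i < n, x.1 i = y.1 i) →
    |birkhoffSum (shift R) f n x - birkhoffSum (shift R) f n y| ≤ C

variable (ν : Measure (SFT R))

/-- The class `φ` in `L^∞(ν)` is represented by a `ν`-weak Bowen function with constant `C`. -/
def HasBowenConst (φ : Lp ℝ ∞ ν) (C : ℝ) : Prop :=
  ∃ (D : Set (SFT R)) (f : SFT R → ℝ), IsWeakBowen R D f C ∧ D ∈ ae ν ∧ φ =ᵐ[ν] f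

/-- The Bowen constant: the infimum of the constants in the Bowen condition. -/
def bowenConst (φ : Lp ℝ ∞ ν) : ℝ := sInf {C | HasBowenConst R ν φ C}

variable {R ν}

lemma HasBowenConst.zero : ∀ C : ℝ, 0 < C → HasBowenConst R ν 0 C := fun C hC =>
  ⟨Set.univ, 0, ⟨dense_univ, fun _ _ => Set.mem_univ _, ⟨0, by simp⟩, hC,
    fun n _ x _ y _ _ => by simp [birkhoffSum, hC.le]⟩, univ_mem, Lp.coeFn_zero _ _ _⟩

lemma HasBowenConst.add [ν.IsOpenPosMeasure] {φ ψ : Lp ℝ ∞ ν} {C C' : ℝ}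
    (h : HasBowenConst R ν φ C) (h' : HasBowenConst R ν ψ C') :
    HasBowenConst R ν (φ + ψ) (C + C') := by
  obtain ⟨D, f, hf, hD, hφ⟩ := h
  obtain ⟨D', f', hf', hD', hψ⟩ := h'
  refine ⟨D ∩ D', f + f', ⟨?_, ?_, ?_, add_pos hf.pos hf'.pos, ?_⟩, inter_mem hD hD', ?_⟩
  · exact Measure.dense_of_ae (inter_mem hD hD')
  · exact fun x hx => ⟨hf.invariant hx.1, hf'.invariant hx.2⟩
  · obtain ⟨K, hK⟩ := hf.bounded
    obtain ⟨K', hK'⟩ := hf'.bounded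
    exact ⟨K + K', fun x hx => (abs_add_le _ _).trans (add_le_add (hK x hx.1) (hK' x hx.2))⟩
  · intro n hn x hx y hy hxy
    have e : ∀ z, birkhoffSum (shift R) (f + f') n z =
        birkhoffSum (shift R) f n z + birkhoffSum (shift R) f' n z := fun z => by
      simp [birkhoffSum, Finset.sum_add_distrib]
    rw [e, e, add_sub_add_comm]
    exact (abs_add_le _ _).trans (add_le_add (hf.bowen n hn x hx.1 y hy.1 hxy)
      (hf'.bowen n hn x hx.2 y hy.2 hxy))
  · exact (Lp.coeFn_add φ ψ).trans (hφ.add hψ)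

lemma HasBowenConst.smul {φ : Lp ℝ ∞ ν} {C : ℝ} (h : HasBowenConst R ν φ C) {c : ℝ}
    (hc : c ≠ 0) : HasBowenConst R ν (c • φ) (|c| * C) := by
  obtain ⟨D, f, hf, hD, hφ⟩ := h
  refine ⟨D, c • f, ⟨hf.dense, hf.invariant, ?_, mul_pos (abs_pos.2 hc) hf.pos, ?_⟩, hD, ?_⟩
  · obtain ⟨K, hK⟩ := hf.bounded
    refine ⟨|c| * K, fun x hx => ?_⟩
    rw [Pi.smul_apply, smul_eq_mul, abs_mul]
    exact mul_le_mul_of_nonneg_left (hK x hx) (abs_nonneg c)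
  · intro n hn x hx y hy hxy
    have e : ∀ z, birkhoffSum (shift R) (c • f) n z = c * birkhoffSum (shift R) f n z := fun z => by
      simp [birkhoffSum, Finset.mul_sum]
    rw [e, e, ← mul_sub, abs_mul]
    exact mul_le_mul_of_nonneg_left (hf.bowen n hn x hx y hy hxy) (abs_nonneg c)
  · exact (Lp.coeFn_smul c φ).trans (hφ.const_smul c)

lemma HasBowenConst.pos {φ : Lp ℝ ∞ ν} {C : ℝ} (h : HasBowenConst R ν φ C) : 0 < C := by
  obtain ⟨D, f, hf, -⟩ := h
  exact hf.pos

lemma bowenConst_le {φ : Lp ℝ ∞ ν} {C : ℝ} (h : HasBowenConst R ν φ C) :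
    bowenConst R ν φ ≤ C :=
  csInf_le ⟨0, fun _ h => (HasBowenConst.pos h).le⟩ h

lemma bowenConst_zero : bowenConst R ν 0 = 0 :=
  le_antisymm (le_of_forall_pos_le_add fun ε hε => by
      simpa using bowenConst_le (HasBowenConst.zero (R := R) (ν := ν) ε hε))
    (Real.sInf_nonneg fun _ h => (HasBowenConst.pos h).le)

variable (R ν)

/-- The space of (classes in `L^∞(ν)` of) `ν`-weak Bowen functions. -/
def weakBowen [ν.IsOpenPosMeasure] : Submodule ℝ (Lp ℝ ∞ ν) where
  carrier := {φ | ∃ C, HasBowenConst R ν φ C}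
  zero_mem' := ⟨1, HasBowenConst.zero 1 one_pos⟩
  add_mem' := fun ⟨C, hC⟩ ⟨C', hC'⟩ => ⟨C + C', hC.add hC'⟩
  smul_mem' := by
    rintro c φ ⟨C, hC⟩
    by_cases hc : c = 0
    · subst hc
      rw [zero_smul]
      exact ⟨1, HasBowenConst.zero 1 one_pos⟩
    · exact ⟨|c| * C, hC.smul hc⟩

/-- The `L^∞`-coboundaries `u - u ∘ τ`, with `u` in `L^∞(ν)`. -/
def coboundaries : Submodule ℝ (Lp ℝ ∞ ν) where
  carrier := {φ | ∃ u : SFT R → ℝ, MemLp u ∞ ν ∧ φ =ᵐ[ν] fun x => u x - u (shift R x)}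
  zero_mem' := ⟨0, MemLp.zero, by
    filter_upwards [Lp.coeFn_zero ℝ ∞ ν] with x hx
    rw [hx]
    simp⟩
  add_mem' := by
    rintro φ ψ ⟨u, hu, hφ⟩ ⟨v, hv, hψ⟩
    refine ⟨u + v, hu.add hv, ?_⟩
    filter_upwards [Lp.coeFn_add φ ψ, hφ, hψ] with x h₁ h₂ h₃
    rw [h₁, Pi.add_apply, h₂, h₃, Pi.add_apply, Pi.add_apply]
    ring
  smul_mem' := by
    rintro c φ ⟨u, hu, hφ⟩
    refine ⟨c • u, hu.const_smul c, ?_⟩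
    filter_upwards [Lp.coeFn_smul c φ, hφ] with x h₁ h₂
    rw [h₁, Pi.smul_apply, h₂, Pi.smul_apply, Pi.smul_apply, smul_sub]

/-- The vector space of `ν`-weak Bowen functions as a type of its own: it carries the Bowen norm
(the sum of the Bowen constant and the `L^∞` norm) and not just the `L^∞` norm. -/
def Bow [ν.IsOpenPosMeasure] : Type := weakBowen R ν

variable [ν.IsOpenPosMeasure]

instance : AddCommGroup (Bow R ν) := inferInstanceAs (AddCommGroup (weakBowen R ν))

instance : Module ℝ (Bow R ν) := inferInstanceAs (Module ℝ (weakBowen R ν))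

/-- The inclusion of the weak Bowen functions into `L^∞(ν)`. -/
def Bow.incl : Bow R ν →ₗ[ℝ] Lp ℝ ∞ ν := (weakBowen R ν).subtype

instance : CoeFun (Bow R ν) (fun _ => SFT R → ℝ) := ⟨fun φ => Bow.incl R ν φ⟩

instance : Norm (Bow R ν) := ⟨fun φ => bowenConst R ν (Bow.incl R ν φ) + ‖Bow.incl R ν φ‖⟩

lemma Bow.norm_smul_le' (c : ℝ) (φ : Bow R ν) : ‖c • φ‖ ≤ |c| * ‖φ‖ := by
  change bowenConst R ν (Bow.incl R ν (c • φ)) + ‖Bow.incl R ν (c • φ)‖ ≤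
    |c| * (bowenConst R ν (Bow.incl R ν φ) + ‖Bow.incl R ν φ‖)
  rw [map_smul, norm_smul, mul_add, Real.norm_eq_abs]
  refine add_le_add ?_ le_rfl
  by_cases hc : c = 0
  · subst hc
    simp [bowenConst_zero]
  · rw [← div_le_iff₀' (abs_pos.2 hc)]
    refine le_csInf φ.2 fun C hC => ?_
    rw [div_le_iff₀' (abs_pos.2 hc)]
    exact bowenConst_le (HasBowenConst.smul hC hc)

lemma Bow.norm_add_le' (φ ψ : Bow R ν) : ‖φ + ψ‖ ≤ ‖φ‖ + ‖ψ‖ := by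
  have h : bowenConst R ν (Bow.incl R ν (φ + ψ)) ≤
      bowenConst R ν (Bow.incl R ν φ) + bowenConst R ν (Bow.incl R ν ψ) := by
    rw [← sub_le_iff_le_add]
    refine le_csInf φ.2 fun C hC => ?_
    rw [sub_le_comm]
    refine le_csInf ψ.2 fun C' hC' => ?_
    rw [sub_le_iff_le_add', map_add]
    exact bowenConst_le (HasBowenConst.add hC hC')
  have h' := norm_add_le (Bow.incl R ν φ) (Bow.incl R ν ψ)
  rw [← map_add] at h'
  change bowenConst R ν (Bow.incl R ν (φ + ψ)) + ‖Bow.incl R ν (φ + ψ)‖ ≤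
    (bowenConst R ν (Bow.incl R ν φ) + ‖Bow.incl R ν φ‖) +
    (bowenConst R ν (Bow.incl R ν ψ) + ‖Bow.incl R ν ψ‖)
  linarith

instance : SeminormedAddCommGroup (Bow R ν) :=
  AddGroupSeminorm.toSeminormedAddCommGroup
    { toFun := fun φ => ‖φ‖
      map_zero' := by
        change bowenConst R ν (Bow.incl R ν 0) + ‖Bow.incl R ν 0‖ = 0
        simp [bowenConst_zero]
      add_le' := Bow.norm_add_le' R ν
      neg' := fun φ => by
        have h : ∀ ψ : Bow R ν, ‖-ψ‖ ≤ ‖ψ‖ := fun ψ => by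
          simpa using Bow.norm_smul_le' R ν (-1 : ℝ) ψ
        exact le_antisymm (h φ) (by simpa using h (-φ)) }

instance : NormedSpace ℝ (Bow R ν) where
  norm_smul_le := Bow.norm_smul_le' R ν

/-- Weak Bowen functions modulo `L^∞`-coboundaries, with the quotient norm. -/
abbrev BowQuot : Type := Bow R ν ⧸ (coboundaries R ν).comap (Bow.incl R ν)

end WeakBowen

end

/-! A quasimorphism is read along orbits. Put `h n x = L (x₀ ⋯ xₙ₋₁)` and let `D` be the defect of
`L`; then `h (n + m)` differs from `h n + h m ∘ τⁿ` by at most `D`.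

From `L` to a potential: the Cesàro averages `cesaro L N` have Birkhoff sums within `D (1 + n / N)`
of `h n` (`abs_birkhoffSum_cesaro_sub_le`). The conditions "`Sₙv` is within `D (1 + n / (N + 1))` of
`h n` for all `n`" define closed convex subsets of `L²(ν)`, decreasing in `N` and meeting a common
ball. A Hilbert space argument in place of weak compactness gives a common point `v`
(`exists_birkhoffSum_sub_le`). Its Birkhoff sums stay within `D` of `h n`; so `v` is bounded (case
`n = 1`), and comparing two points of one cylinder through the common value of `L` gives the Bowen
condition.

From a potential to `L`: choose a good point in the cylinder of each word `a` and let `L a` be the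
Birkhoff sum of length `|a|` there. The Bowen condition makes the choice immaterial up to a constant
(`exists_isAssociated_right`).

If `L` and `φ` are associated, then `L` is bounded iff the Birkhoff sums of `φ` are essentially
bounded, iff `φ` is an `L^∞`-coboundary (`IsAssociated.mem_iff`). Full support of `ν` is what turns
almost sure bounds into bounds on all words. So association descends to a linear bijection of the
quotients, and the explicit constants in both constructions make it bicontinuous.

Quasimorphisms are complete under their seminorm. Specification shows that the bounded ones form a
closed subspace, because their supremum is at most twice their norm. The Banach property of the
other quotient is transported through the isomorphism. -/

noncomputable section

namespace WeakBowen

/-! ### Words read along orbits, and growth of quasimorphisms -/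

section Words

variable {d : ℕ} {R : Matrix (Fin d) (Fin d) ℕ} {M : ℕ}

lemma shift_iterate_apply (x : SFT R) (n i : ℕ) : ((shift R)^[n] x).1 i = x.1 (i + n) := by
  induction n generalizing x with
  | zero => rfl
  | succ n ih =>
    rw [Function.iterate_succ_apply, ih]
    change x.1 (i + n + 1) = _
    rw [add_assoc]

lemma initialWord_eq_iff {x y : SFT R} {n : ℕ} :
    initialWord R x n = initialWord R y n ↔ ∀ i < n, x.1 i = y.1 i := by
  rw [Subtype.ext_iff]
  change List.ofFn _ = List.ofFn _ ↔ _
  rw [List.ofFn_inj, funext_iff]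
  exact ⟨fun h i hi => h ⟨i, hi⟩, fun h i => h i i.2⟩

@[simp] lemma length_initialWord (x : SFT R) (n : ℕ) : (initialWord R x n).1.length = n := by
  simp [initialWord]

lemma initialWord_add (x : SFT R) (n m : ℕ) :
    (initialWord R x (n + m)).1 =
      (initialWord R x n).1 ++ (initialWord R ((shift R)^[n] x) m).1 := by
  change List.ofFn _ = List.ofFn _ ++ List.ofFn _
  rw [List.ofFn_add]
  congr 1
  refine congrArg List.ofFn (funext fun i => ?_)
  rw [shift_iterate_apply]
  exact congrArg x.1 (add_comm n i)

lemma initialWord_of_isWord {a : List (Fin d)} {x : SFT R}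
    (h : ∀ (i : ℕ) (h : i < a.length), a[i] = x.1 i) : (initialWord R x a.length).1 = a := by
  refine List.ext_getElem (by simp) fun i h₁ h₂ => ?_
  rw [h i h₂]
  simp [initialWord]

lemma exists_initialWord [Nonempty (SFT R)] (a : Word R) :
    ∃ x : SFT R, initialWord R x a.1.length = a := by
  obtain ⟨a, rfl | ⟨x, hx⟩⟩ := a
  · exact ⟨Classical.arbitrary _, Subtype.ext (by simp [initialWord])⟩
  · exact ⟨x, Subtype.ext (initialWord_of_isWord hx)⟩

/-- Every pair of words with an allowed concatenation is read off from one point. -/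
lemma exists_initialWord_concat [Nonempty (SFT R)] (p : ConcatPair R) :
    ∃ x : SFT R, initialWord R x p.1.1.1.length = p.1.1 ∧
      initialWord R ((shift R)^[p.1.1.1.length] x) p.1.2.1.length = p.1.2 ∧
      initialWord R x (p.1.1.1.length + p.1.2.1.length) = ⟨p.1.1.1 ++ p.1.2.1, p.2⟩ := by
  obtain ⟨x, hx⟩ := exists_initialWord (R := R) ⟨p.1.1.1 ++ p.1.2.1, p.2⟩
  simp only [List.length_append] at hx
  have h := Subtype.ext_iff.1 hx
  rw [initialWord_add] at h
  obtain ⟨h₁, h₂⟩ := List.append_inj h (by simp)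
  exact ⟨x, Subtype.ext h₁, Subtype.ext h₂, hx⟩

lemma delta_le_defect (L : QM R M) (p : ConcatPair R) : |delta R L p| ≤ defect R L :=
  le_ciSup (bddAbove_delta R L) p

lemma defect_nonneg (L : Word R → ℝ) : 0 ≤ defect R L := Real.iSup_nonneg fun _ => abs_nonneg _

lemma shortSup_nonneg (L : Word R → ℝ) : 0 ≤ shortSup R M L :=
  Real.iSup_nonneg fun _ => abs_nonneg _

lemma le_shortSup (L : Word R → ℝ) {a : Word R} (ha : a.1.length ≤ M) : |L a| ≤ shortSup R M L :=
  le_ciSup (f := fun a : {a : Word R // a.1.length ≤ M} => |L a.1|)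
    (Set.finite_range _).bddAbove ⟨a, ha⟩

lemma QM.norm_def (L : QM R M) : ‖L‖ = shortSup R M L + defect R L := rfl

lemma QM.sub_apply (L L' : QM R M) (a : Word R) : (L - L') a = L a - L' a := rfl

/-- Quasimorphisms are approximately additive along orbits. -/
lemma abs_initialWord_add_sub_le (L : QM R M) (x : SFT R) (n m : ℕ) :
    |L (initialWord R x (n + m)) - L (initialWord R x n) -
      L (initialWord R ((shift R)^[n] x) m)| ≤ defect R L := by
  have h := initialWord_add x n m
  have h' := delta_le_defect L ⟨(initialWord R x n, initialWord R ((shift R)^[n] x) m),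
    h ▸ (initialWord R x (n + m)).2⟩
  have e : initialWord R x (n + m) = ⟨_, h ▸ (initialWord R x (n + m)).2⟩ := Subtype.ext h
  rw [e]
  exact h'

/-- Splitting the empty word as itself twice gives `δL(∅, ∅) = -L(∅)`. -/
lemma abs_emptyWord_le (L : QM R M) (x : SFT R) : |L (initialWord R x 0)| ≤ defect R L := by
  have h := abs_initialWord_add_sub_le L x 0 0
  simpa using h

lemma defect_le_of_orbit [Nonempty (SFT R)] {L : Word R → ℝ} {C : ℝ}
    (h : ∀ (x : SFT R) (n m : ℕ), |L (initialWord R x (n + m)) - L (initialWord R x n) -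
      L (initialWord R ((shift R)^[n] x) m)| ≤ C) (p : ConcatPair R) : |delta R L p| ≤ C := by
  obtain ⟨x, h₁, h₂, h₃⟩ := exists_initialWord_concat p
  have h' := h x p.1.1.1.length p.1.2.1.length
  rwa [h₁, h₂, h₃] at h'

/-- Quasimorphisms grow at most linearly, with the norm as the rate. -/
lemma abs_initialWord_le (hM : 0 < M) (L : QM R M) (x : SFT R) (n : ℕ) :
    |L (initialWord R x n)| ≤ (n + 1) * ‖L‖ := by
  have h0 := QM.norm_def L
  have hd := defect_nonneg (R := R) L
  have hs := shortSup_nonneg (R := R) (M := M) L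
  induction n with
  | zero =>
    have := le_shortSup (M := M) L (a := initialWord R x 0) (by simp)
    push_cast
    linarith
  | succ n ih =>
    have h := abs_le.1 (abs_initialWord_add_sub_le L x n 1)
    -- One letter is appended at a time; since `0 < M`, one-letter words are controlled by the norm.
    have h₁ := abs_le.1 (le_shortSup (M := M) L (a := initialWord R ((shift R)^[n] x) 1)
      (by rw [length_initialWord]; exact hM))
    have ih := abs_le.1 ih
    push_cast
    rw [abs_le]
    constructor <;> nlinarith

lemma abs_apply_le [Nonempty (SFT R)] (hM : 0 < M) (L : QM R M) (a : Word R) :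
    |L a| ≤ (a.1.length + 1) * ‖L‖ := by
  obtain ⟨x, hx⟩ := exists_initialWord a
  rw [← hx]
  simpa using abs_initialWord_le hM L x a.1.length

/-! ### Specification -/

/-- A positive entry of `R ^ k` means that there is a path of `k` allowed transitions from `i` to
`y₀`; its symbols are prepended to `y` one by one. -/
lemma exists_preimage_of_pow_pos (hR : ∀ i j, R i j = 0 ∨ R i j = 1) (k : ℕ) (i : Fin d)
    (y : SFT R) (h : 0 < (R ^ k) i (y.1 0)) : ∃ z : SFT R, z.1 0 = i ∧ (shift R)^[k] z = y := by
  induction k generalizing i with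
  | zero =>
    refine ⟨y, ?_, rfl⟩
    by_contra hne
    simp [Matrix.one_apply_ne (Ne.symm hne)] at h
  | succ k ih =>
    rw [pow_succ', Matrix.mul_apply] at h
    obtain ⟨j, -, hj⟩ := Finset.exists_ne_zero_of_sum_ne_zero h.ne'
    obtain ⟨z, hz, hzy⟩ := ih j (Nat.pos_of_ne_zero (right_ne_zero_of_mul hj))
    refine ⟨⟨fun n => n.casesOn i z.1, ?_⟩, rfl, ?_⟩
    · rintro (_ | n)
      · change R i (z.1 0) = 1
        rw [hz]
        exact (hR i j).resolve_left (left_ne_zero_of_mul hj)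
      · exact z.2 n
    · refine Eq.trans ?_ hzy
      rw [Function.iterate_succ_apply]
      rfl

/-- The two pieces share the symbol at time `n`, so the agreement with `x` includes `i = n`. This
overlap is why connecting words have length `M - 1` rather than `M`. -/
lemma exists_concat (n : ℕ) (x z : SFT R) (h : z.1 0 = x.1 n) :
    ∃ p : SFT R, (∀ i ≤ n, p.1 i = x.1 i) ∧ (shift R)^[n] p = z := by
  refine ⟨⟨fun i => if i < n then x.1 i else z.1 (i - n), fun i => ?_⟩, fun i hi => ?_, ?_⟩
  · rcases lt_trichotomy (i + 1) n with hi | hi | hi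
    · simpa [hi, Nat.lt_of_succ_lt hi] using x.2 i
    · subst hi
      simpa [h] using x.2 i
    · have e : i + 1 - n = i - n + 1 := by omega
      simpa [show ¬ i < n by omega, show ¬ i + 1 < n by omega, e] using z.2 (i - n)
  · rcases hi.lt_or_eq with hi | rfl
    · simp [hi]
    · simp [h]
  · refine Subtype.ext (funext fun i => ?_)
    rw [shift_iterate_apply]
    simp

/-- Any two points can be joined by a connecting word of length `M - 1`. -/
lemma exists_specification (hR : ∀ i j, R i j = 0 ∨ R i j = 1) (hRM : ∀ i j, 0 < (R ^ M) i j)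
    (x y : SFT R) (n : ℕ) :
    ∃ p : SFT R, (∀ i ≤ n, p.1 i = x.1 i) ∧ (shift R)^[n + M] p = y := by
  obtain ⟨z, hz, hzy⟩ := exists_preimage_of_pow_pos hR M (x.1 n) y (hRM _ _)
  obtain ⟨p, hp, hpz⟩ := exists_concat n x z hz
  exact ⟨p, hp, by rw [add_comm, Function.iterate_add_apply, hpz, hzy]⟩

/-- The supremum of a bounded quasimorphism is controlled by its norm. -/
lemma abs_le_two_mul_norm_of_bounded [Nonempty (SFT R)]
    (hR : ∀ i j, R i j = 0 ∨ R i j = 1) (hM : 0 < M) (hRM : ∀ i j, 0 < (R ^ M) i j)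
    {L : QM R M} (hL : L ∈ boundedQM R M) (a : Word R) : |L a| ≤ 2 * ‖L‖ := by
  obtain ⟨C, hC⟩ := hL
  have hb : BddAbove (Set.range fun a => |L a|) := ⟨C, by rintro _ ⟨a, rfl⟩; exact hC a⟩
  have hs : ∀ a, |L a| ≤ ⨆ a, |L a| := le_ciSup hb
  have h0 := QM.norm_def L
  have hd := defect_nonneg (R := R) L
  have hss := shortSup_nonneg (R := R) (M := M) L
  have : Nonempty (Word R) := ⟨a⟩
  -- A self-improving estimate: if `s` is the supremum, `s ≤ (s + 2‖L‖) / 2` forces `s ≤ 2‖L‖`.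
  -- Finiteness of `s` is needed here.
  suffices h : ∀ a, |L a| ≤ ((⨆ a, |L a|) + 2 * ‖L‖) / 2 by
    have := ciSup_le h
    exact (hs a).trans (by linarith)
  intro a
  obtain ⟨x, hx⟩ := exists_initialWord a
  obtain hn | ⟨n, hn⟩ : a.1.length = 0 ∨ ∃ n, a.1.length = n + 1 := by
    cases a.1.length with
    | zero => exact .inl rfl
    | succ n => exact .inr ⟨n, rfl⟩
  · have := le_shortSup (M := M) L (a := a) (by omega)
    have := hs a
    linarith
  · rw [hn] at hx
    -- Follow `a`, then a connecting word `w` of length `M - 1`, then `a` again. Since `L(awa)` is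
    -- within twice the defect of `2 L(a) + L(w)`, the value `2|L(a)|` is at most `s + 2‖δL‖ +
    -- |L(w)|`.
    obtain ⟨p, hp, hpx⟩ := exists_specification hR hRM x x n
    have e : initialWord R p (n + 1) = a := by
      rw [← hx, initialWord_eq_iff]
      exact fun i hi => hp i (by omega)
    have h₁ := abs_le.1 (abs_initialWord_add_sub_le L p (n + M) (n + 1))
    have h₂ := abs_le.1 (abs_initialWord_add_sub_le L p (n + 1) (M - 1))
    have h₃ := abs_le.1 (le_shortSup (M := M) L
      (a := initialWord R ((shift R)^[n + 1] p) (M - 1)) (by simp))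
    have h₄ := abs_le.1 (hs (initialWord R p (n + M + (n + 1))))
    rw [hpx, hx] at h₁
    rw [show n + 1 + (M - 1) = n + M by omega, e] at h₂
    rw [abs_le]
    constructor <;> linarith

/-- The bounded quasimorphisms are closed: approximants of `L` that are close in norm to each other
are uniformly close, by the bound of the supremum by twice the norm. -/
lemma mem_boundedQM_of_norm_mk_eq_zero [Nonempty (SFT R)]
    (hR : ∀ i j, R i j = 0 ∨ R i j = 1) (hM : 0 < M) (hRM : ∀ i j, 0 < (R ^ M) i j)
    {L : QM R M} (hL : ‖(Submodule.Quotient.mk L : QMQuot R M)‖ = 0) : L ∈ boundedQM R M := by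
  have key : ∀ ε : ℝ, 0 < ε → ∃ B ∈ boundedQM R M, ‖L - B‖ < ε := fun ε hε => by
    obtain ⟨L', h, h'⟩ := Submodule.Quotient.norm_mk_lt (Submodule.Quotient.mk L : QMQuot R M) hε
    refine ⟨L - L', (Submodule.Quotient.eq _).1 h.symm, ?_⟩
    rw [hL, zero_add] at h'
    simpa using h'
  obtain ⟨B₁, ⟨C, hC⟩, h₁⟩ := key 1 one_pos
  -- `C` bounds `B₁`, `4` bounds `B - B₁` (whose norm is at most `2`), and `1` bounds `L - B` at the
  -- given word.
  refine ⟨C + 5, fun a => ?_⟩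
  -- The approximant depends on `a`: its precision offsets the linear growth factor `|a| + 1`.
  obtain ⟨B, hB, h⟩ := key (1 / (a.1.length + 1)) (by positivity)
  have h2 := abs_apply_le hM (L - B) a
  have h3 : (a.1.length + 1 : ℝ) * ‖L - B‖ ≤ 1 := by
    rw [lt_div_iff₀ (by positivity)] at h
    linarith
  have hle : ‖L - B‖ ≤ 1 := by
    refine le_trans ?_ h3
    nlinarith [norm_nonneg (L - B), Nat.cast_nonneg (α := ℝ) a.1.length]
  have h4 := abs_le_two_mul_norm_of_bounded hR hM hRM
    (Submodule.sub_mem _ hB (⟨C, hC⟩ : B₁ ∈ boundedQM R M)) a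
  have h5 : ‖B - B₁‖ ≤ 2 := by
    have : B - B₁ = (L - B₁) - (L - B) := by abel
    rw [this]
    exact (norm_sub_le _ _).trans (by linarith)
  have h6 := abs_le.1 (hC a)
  have h7 := abs_le.1 (h2.trans h3)
  have h8 := abs_le.1 h4
  rw [QM.sub_apply] at h7 h8
  rw [abs_le]
  constructor <;> linarith

/-! ### Completeness of the space of quasimorphisms -/

lemma QM.norm_le {L : QM R M} {C C' : ℝ} (h : ∀ a : Word R, a.1.length ≤ M → |L a| ≤ C)
    (h' : ∀ p, |delta R L p| ≤ C') : ‖L‖ ≤ C + C' :=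
  add_le_add (ciSup_le fun a => h a.1 a.2) (ciSup_le h')

/-- By linear growth, Cauchy sequences converge at each word. The defect at a pair involves only
three values, so the uniform estimates pass to the pointwise limit. -/
theorem completeSpace_QM [Nonempty (SFT R)] (hM : 0 < M) : CompleteSpace (QM R M) := by
  refine Metric.complete_of_cauchySeq_tendsto fun u hu => ?_
  have hu' : ∀ ε > 0, ∃ N, ∀ m ≥ N, ∀ n ≥ N, ‖u m - u n‖ < ε := fun ε hε => by
    simpa only [dist_eq_norm] using Metric.cauchySeq_iff.1 hu ε hε
  have hpt : ∀ a, CauchySeq fun n => (u n) a := fun a => by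
    refine Metric.cauchySeq_iff.2 fun ε hε => ?_
    obtain ⟨N, hN⟩ := hu' (ε / (a.1.length + 1)) (by positivity)
    refine ⟨N, fun m hm n hn => ?_⟩
    have h := hN m hm n hn
    rw [lt_div_iff₀ (by positivity)] at h
    rw [Real.dist_eq]
    exact (abs_apply_le hM (u m - u n) a).trans_lt (by linarith)
  choose L hL using fun a => cauchySeq_tendsto_of_complete (hpt a)
  have hδ : ∀ n p, Tendsto (fun m => delta R (u m - u n : QM R M) p) atTop
      (𝓝 (delta R (L - (u n : Word R → ℝ)) p)) := fun n p =>
    (((hL _).sub_const _).sub ((hL _).sub_const _)).sub ((hL _).sub_const _)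
  have hN : ∀ ε > 0, ∃ N, ∀ n ≥ N, (∀ a : Word R, a.1.length ≤ M → |L a - u n a| ≤ ε) ∧
      ∀ p, |delta R (L - (u n : Word R → ℝ)) p| ≤ ε := fun ε hε => by
    obtain ⟨N, hN⟩ := hu' ε hε
    refine ⟨N, fun n hn => ⟨fun a ha => ?_, fun p => ?_⟩⟩
    · refine le_of_tendsto ((hL a).sub_const _).abs (eventually_atTop.2 ⟨N, fun m hm => ?_⟩)
      have := le_shortSup (u m - u n : QM R M) ha
      have h' := hN m hm n hn
      rw [QM.norm_def] at h'
      have := defect_nonneg (R := R) (u m - u n : QM R M)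
      rw [← QM.sub_apply]
      linarith
    · refine le_of_tendsto (hδ n p).abs (eventually_atTop.2 ⟨N, fun m hm => ?_⟩)
      have := delta_le_defect (u m - u n : QM R M) p
      have h' := hN m hm n hn
      rw [QM.norm_def] at h'
      have := shortSup_nonneg (R := R) (M := M) (u m - u n : QM R M)
      linarith
  have hq : L ∈ quasimorphisms R := by
    obtain ⟨N, h⟩ := hN 1 one_pos
    have h₁ : L - (u N : Word R → ℝ) ∈ quasimorphisms R := ⟨1, (h N le_rfl).2⟩
    simpa using (quasimorphisms R).add_mem h₁ (u N).2
  let L' : QM R M := ⟨L, hq⟩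
  refine ⟨L', tendsto_iff_norm_sub_tendsto_zero.2 (Metric.tendsto_atTop.2 fun ε hε => ?_)⟩
  obtain ⟨N, h⟩ := hN (ε / 3) (by positivity)
  refine ⟨N, fun n hn => ?_⟩
  rw [dist_zero_right, norm_norm, norm_sub_rev]
  exact (QM.norm_le (L := L' - u n) (h n hn).1 (h n hn).2).trans_lt (by linarith)

end Words

end WeakBowen

/-! ### Nested convex sets in a Hilbert space -/

/-- In a Hilbert space, a decreasing sequence of closed convex sets that all meet a fixed ball has
a common point. -/
lemma exists_mem_iInter_of_antitone_convex {H : Type*} [NormedAddCommGroup H]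
    [InnerProductSpace ℝ H] [CompleteSpace H] {K : ℕ → Set H} (hK : Antitone K)
    (hc : ∀ n, Convex ℝ (K n)) (hcl : ∀ n, IsClosed (K n)) {B : ℝ}
    (hB : ∀ n, ∃ v ∈ K n, ‖v‖ ≤ B) : ∃ v, ∀ n, v ∈ K n := by
  -- The points of minimal norm are the candidates: their norms increase and stay below `B`, and the
  -- parallelogram law then makes them a Cauchy sequence.
  have hmin : ∀ n, ∃ v ∈ K n, ∀ w ∈ K n, ‖v‖ ≤ ‖w‖ := fun n => by
    obtain ⟨v, hv, h⟩ := exists_norm_eq_iInf_of_complete_convex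
      ((hB n).imp fun _ h => h.1) (hcl n).isComplete (hc n) 0
    refine ⟨v, hv, fun w hw => ?_⟩
    simp only [zero_sub, norm_neg] at h
    rw [h]
    exact ciInf_le (f := fun w : K n => ‖(w : H)‖)
      ⟨0, by rintro _ ⟨w, rfl⟩; exact norm_nonneg _⟩ ⟨w, hw⟩
  choose v hv hvmin using hmin
  have hle : ∀ n, ‖v n‖ ≤ B := fun n => by
    obtain ⟨w, hw, h⟩ := hB n
    exact (hvmin n w hw).trans h
  have hmono : Monotone fun n => ‖v n‖ ^ 2 := fun n m hnm =>
    pow_le_pow_left₀ (norm_nonneg _) (hvmin n _ (hK hnm (hv m))) 2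
  have hbdd : BddAbove (Set.range fun n => ‖v n‖ ^ 2) := ⟨B ^ 2, by
    rintro _ ⟨n, rfl⟩
    exact pow_le_pow_left₀ (norm_nonneg _) (hle n) 2⟩
  obtain ⟨a, ha⟩ : ∃ a, Tendsto (fun n => ‖v n‖ ^ 2) atTop (𝓝 a) :=
    ⟨_, tendsto_atTop_ciSup hmono hbdd⟩
  have hdist : ∀ n m, n ≤ m → ‖v n - v m‖ ^ 2 ≤ 2 * (a - ‖v n‖ ^ 2) := fun n m hnm => by
    have h₁ := parallelogram_law_with_norm ℝ (v n) (v m)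
    have h₂ : ‖v m‖ ^ 2 ≤ a := hmono.ge_of_tendsto ha m
    -- The midpoint of `v n` and `v m` lies in `K n`, so minimality bounds its norm from below.
    have h₃ : ‖v n‖ ≤ ‖v n + v m‖ / 2 := by
      have hmem := hc n (hv n) (hK hnm (hv m)) (a := 1 / 2) (b := 1 / 2) (by norm_num)
        (by norm_num) (by norm_num)
      have := hvmin n _ hmem
      rw [← smul_add, norm_smul] at this
      norm_num at this
      linarith
    nlinarith [norm_nonneg (v n)]
  have hcauchy : CauchySeq v := by
    refine cauchySeq_of_le_tendsto_0' (fun n => √(2 * (a - ‖v n‖ ^ 2))) (fun n m hnm => ?_) ?_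
    · rw [dist_eq_norm]
      exact Real.le_sqrt_of_sq_le (hdist n m hnm)
    · have : Tendsto (fun n => √(2 * (a - ‖v n‖ ^ 2))) atTop (𝓝 √(2 * (a - a))) :=
        ((tendsto_const_nhds.sub ha).const_mul 2).sqrt
      simpa using this
  obtain ⟨w, hw⟩ := cauchySeq_tendsto_of_complete hcauchy
  exact ⟨w, fun n => (hcl n).mem_of_tendsto hw
    (eventually_atTop.2 ⟨n, fun m hm => hK hm (hv m)⟩)⟩

/-! ### Birkhoff sums and constraints on them in `L²` -/

section Birkhoff

variable {X : Type*} {T : X → X}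

lemma birkhoffSum_lincomb (a b : ℝ) (f g : X → ℝ) (n : ℕ) (x : X) :
    birkhoffSum T (a • f + b • g) n x = a * birkhoffSum T f n x + b * birkhoffSum T g n x := by
  simp [birkhoffSum, Finset.sum_add_distrib, Finset.mul_sum]

lemma birkhoffSum_coboundary (u : X → ℝ) (n : ℕ) (x : X) :
    birkhoffSum T (fun x => u x - u (T x)) n x = u x - u (T^[n] x) := by
  simp only [birkhoffSum, ← Function.iterate_succ_apply' T]
  exact Finset.sum_range_sub' (fun k => u (T^[k] x)) n

lemma abs_birkhoffSum_le {f : X → ℝ} {K : ℝ} {x : X} (h : ∀ k, |f (T^[k] x)| ≤ K) (n : ℕ) :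
    |birkhoffSum T f n x| ≤ n * K := by
  refine (Finset.abs_sum_le_sum_abs _ _).trans ((Finset.sum_le_sum fun k _ => h k).trans ?_)
  simp

variable [MeasurableSpace X] {ν : Measure X}

lemma ae_forall_iterate (hT : MeasurePreserving T ν ν) {p : X → Prop} (hp : ∀ᵐ x ∂ν, p x) :
    ∀ᵐ x ∂ν, ∀ k, p (T^[k] x) :=
  ae_all_iff.2 fun k => (hT.iterate k).quasiMeasurePreserving.ae hp

lemma ae_birkhoffSum_congr (hT : MeasurePreserving T ν ν) {f g : X → ℝ} (h : f =ᵐ[ν] g) :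
    ∀ᵐ x ∂ν, ∀ n, birkhoffSum T f n x = birkhoffSum T g n x := by
  filter_upwards [ae_forall_iterate hT h] with x hx n
  exact Finset.sum_congr rfl fun k _ => hx k

/-- The square integrable functions whose Birkhoff sums stay within `c n` of `h n`. -/
def birkhoffStrip (ν : Measure X) (T : X → X) (h : ℕ → X → ℝ) (c : ℕ → ℝ) : Set (Lp ℝ 2 ν) :=
  {v | ∀ᵐ x ∂ν, ∀ n, |birkhoffSum T v n x - h n x| ≤ c n}

lemma convex_birkhoffStrip (hT : MeasurePreserving T ν ν) (h : ℕ → X → ℝ) (c : ℕ → ℝ) :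
    Convex ℝ (birkhoffStrip ν T h c) := by
  intro v hv w hw a b ha hb hab
  have e : ((a • v + b • w : Lp ℝ 2 ν) : X → ℝ) =ᵐ[ν] a • (v : X → ℝ) + b • (w : X → ℝ) :=
    (Lp.coeFn_add _ _).trans ((Lp.coeFn_smul a v).add (Lp.coeFn_smul b w))
  filter_upwards [hv, hw, ae_birkhoffSum_congr hT e] with x h₁ h₂ h₃ n
  rw [h₃, birkhoffSum_lincomb]
  have e' : a * birkhoffSum T v n x + b * birkhoffSum T w n x - h n x =
      a * (birkhoffSum T v n x - h n x) + b * (birkhoffSum T w n x - h n x) := by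
    linear_combination h n x * hab
  rw [e']
  refine (abs_add_le _ _).trans ?_
  rw [abs_mul, abs_mul, abs_of_nonneg ha, abs_of_nonneg hb]
  calc _ ≤ a * c n + b * c n :=
        add_le_add (mul_le_mul_of_nonneg_left (h₁ n) ha) (mul_le_mul_of_nonneg_left (h₂ n) hb)
    _ = c n := by rw [← add_mul, hab, one_mul]

/-- A subsequence of an `L²`-convergent sequence converges almost everywhere. By invariance of `ν`
it does so along whole orbits, hence all Birkhoff sums converge. -/
lemma isClosed_birkhoffStrip (hT : MeasurePreserving T ν ν) (h : ℕ → X → ℝ) (c : ℕ → ℝ) :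
    IsClosed (birkhoffStrip ν T h c) := by
  refine IsSeqClosed.isClosed fun u v hu huv => ?_
  obtain ⟨φ, -, hφ⟩ := (tendstoInMeasure_of_tendsto_Lp huv).exists_seq_tendsto_ae
  filter_upwards [ae_forall_iterate hT hφ, ae_all_iff.2 hu] with x h₁ h₂ n
  refine le_of_tendsto (x := atTop) (f := fun i => |birkhoffSum T (u (φ i)) n x - h n x|)
    ((Tendsto.sub_const ?_ _).abs) (Eventually.of_forall fun i => h₂ (φ i) n)
  exact tendsto_finsetSum _ fun k _ => h₁ k

end Birkhoff

namespace WeakBowen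

/-! ### Constructing the potential of a quasimorphism -/

section Potential

variable {d : ℕ} {R : Matrix (Fin d) (Fin d) ℕ} {M : ℕ} {ν : Measure (SFT R)}

lemma measurable_initialWord (L : Word R → ℝ) (n : ℕ) :
    Measurable fun x : SFT R => L (initialWord R x n) := by
  classical
  -- The function depends only on `n` letters, so it factors through a finite discrete space; the
  -- value `0` at forbidden words is never attained.
  let g : (Fin n → Fin d) → ℝ := fun t =>
    if h : IsWord R (List.ofFn t) then L ⟨List.ofFn t, h⟩ else 0
  have hg : Measurable g := measurable_of_countable g
  have hr : Measurable fun (x : SFT R) (i : Fin n) => x.1 i :=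
    measurable_pi_lambda _ fun i => (measurable_pi_apply (i : ℕ)).comp measurable_subtype_coe
  convert hg.comp hr using 1
  funext x
  have h : IsWord R (List.ofFn fun i : Fin n => x.1 i) := (initialWord R x n).2
  simp only [Function.comp, g, dif_pos h]
  rfl

/-- The Cesàro averages of the functions `x ↦ L (x₀ ⋯ xⱼ₋₁) - L (x₁ ⋯ xⱼ₋₁)`. -/
def cesaro (L : Word R → ℝ) (N : ℕ) (x : SFT R) : ℝ :=
  (N : ℝ)⁻¹ * ((∑ j ∈ Finset.range N, L (initialWord R x j) -
    ∑ j ∈ Finset.range N, L (initialWord R (shift R x) j)) + L (initialWord R x N))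

/-- With `H = ∑_{j<N} h j`, the coboundary part of `N • cesaro L N` telescopes to `H - H ∘ τⁿ`.
Quasi-additivity rewrites `H ∘ τⁿ` with error `N D` and the sum of the `h N ∘ τⁱ` with error `n D`;
the remaining terms cancel to `N h n`. -/
lemma abs_birkhoffSum_cesaro_sub_le (L : QM R M) {N : ℕ} (hN : 0 < N) (n : ℕ) (x : SFT R) :
    |birkhoffSum (shift R) (cesaro L N) n x - L (initialWord R x n)| ≤
      defect R L * (1 + n / N) := by
  have hN' : (0 : ℝ) < N := Nat.cast_pos.2 hN
  set D := defect R L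
  let h : ℕ → SFT R → ℝ := fun j x => L (initialWord R x j)
  let H : SFT R → ℝ := fun x => ∑ j ∈ Finset.range N, h j x
  have hA : |∑ j ∈ Finset.range N, (h (n + j) x - h n x - h j ((shift R)^[n] x))| ≤ N * D := by
    refine (Finset.abs_sum_le_sum_abs _ _).trans ((Finset.sum_le_sum fun j _ =>
      abs_initialWord_add_sub_le L x n j).trans (by simp [D]))
  have hB : |∑ i ∈ Finset.range n, (h (i + N) x - h i x - h N ((shift R)^[i] x))| ≤ n * D := by
    refine (Finset.abs_sum_le_sum_abs _ _).trans ((Finset.sum_le_sum fun i _ =>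
      abs_initialWord_add_sub_le L x i N).trans (by simp [D]))
  have hS : N * birkhoffSum (shift R) (cesaro L N) n x =
      H x - H ((shift R)^[n] x) + ∑ i ∈ Finset.range n, h N ((shift R)^[i] x) := by
    rw [← birkhoffSum_coboundary H n x, birkhoffSum, birkhoffSum, ← Finset.sum_add_distrib,
      Finset.mul_sum]
    refine Finset.sum_congr rfl fun i _ => ?_
    rw [cesaro, mul_inv_cancel_left₀ hN'.ne']
  -- Both sides compare with the sum of `h` over `range (n + N)`, split after `n` terms or after `N`
  -- terms.
  have hI : ∑ j ∈ Finset.range N, h (n + j) x - H x =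
      ∑ i ∈ Finset.range n, h (i + N) x - ∑ i ∈ Finset.range n, h i x := by
    have h₁ := Finset.sum_range_add (fun j => h j x) n N
    have h₂ := Finset.sum_range_add (fun j => h j x) N n
    rw [add_comm n N, h₂] at h₁
    simp only [add_comm N] at h₁
    simp only [H]
    linarith
  simp only [Finset.sum_sub_distrib, Finset.sum_const, Finset.card_range, nsmul_eq_mul] at hA hB
  have hmul : (N : ℝ) * |birkhoffSum (shift R) (cesaro L N) n x - h n x| ≤ N * D + n * D := by
    rw [← abs_of_pos hN', ← abs_mul, abs_of_pos hN', mul_sub, hS]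
    have h₁ := abs_le.1 hA
    have h₂ := abs_le.1 hB
    simp only [H] at hI ⊢
    rw [abs_le]
    constructor <;> linarith
  rw [← le_div_iff₀' hN'] at hmul
  refine hmul.trans (le_of_eq ?_)
  field_simp

/-- The key existence statement: a quasimorphism is, up to its defect, the Birkhoff sum of a
function. -/
theorem exists_birkhoffSum_sub_le [IsProbabilityMeasure ν] (hν : MeasurePreserving (shift R) ν ν)
    (hM : 0 < M) (L : QM R M) : ∃ v : SFT R → ℝ, AEStronglyMeasurable v ν ∧
      ∀ᵐ x ∂ν, ∀ n, |birkhoffSum (shift R) v n x - L (initialWord R x n)| ≤ defect R L := by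
  set D := defect R L
  have hD : 0 ≤ D := defect_nonneg _
  let h : ℕ → SFT R → ℝ := fun j x => L (initialWord R x j)
  -- The index is shifted to `N + 1` to avoid averaging over an empty range.
  let c : ℕ → ℕ → ℝ := fun N n => D * (1 + n / (N + 1 : ℕ))
  have hmeas : ∀ N, Measurable (cesaro (R := R) L N) := fun N =>
    (((Finset.measurable_sum _ fun j _ => measurable_initialWord L j).sub
      (Finset.measurable_sum _ fun j _ => (measurable_initialWord L j).comp hν.measurable)).add
      (measurable_initialWord L N)).const_mul _
  -- The case `n = 1` of the Cesàro estimate bounds all averages uniformly, which supplies the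
  -- common ball.
  have hle : ∀ N x, ‖cesaro (R := R) L (N + 1) x‖ ≤ shortSup R M L + 2 * D := fun N x => by
    have h₁ := abs_birkhoffSum_cesaro_sub_le L N.succ_pos 1 x
    rw [birkhoffSum_one] at h₁
    have h₂ := le_shortSup (M := M) L (a := initialWord R x 1)
      (by rw [length_initialWord]; exact hM)
    have h₃ : D * (1 + (1 : ℕ) / (N + 1 : ℕ)) ≤ 2 * D := by
      have : ((1 : ℕ) / (N + 1 : ℕ) : ℝ) ≤ 1 :=
        div_le_one_of_le₀ (by push_cast; linarith [Nat.cast_nonneg (α := ℝ) N]) (by positivity)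
      nlinarith
    have h₄ := abs_le.1 (h₁.trans h₃)
    have h₅ := abs_le.1 h₂
    rw [Real.norm_eq_abs, abs_le]
    constructor <;> linarith
  obtain ⟨v, hv⟩ := exists_mem_iInter_of_antitone_convex
    (K := fun N => birkhoffStrip ν (shift R) h (c N)) (B := shortSup R M L + 2 * D)
    (fun N N' hNN v hv => by
      change ∀ᵐ x ∂ν, _
      filter_upwards [show ∀ᵐ x ∂ν, _ from hv] with x hx n
      refine (hx n).trans (mul_le_mul_of_nonneg_left (add_le_add_right ?_ 1) hD)
      gcongr)
    (fun N => convex_birkhoffStrip hν _ _) (fun N => isClosed_birkhoffStrip hν _ _)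
    (fun N => by
      have hmem : MemLp (cesaro (R := R) L (N + 1)) 2 ν :=
        MemLp.of_bound (hmeas _).aestronglyMeasurable _ (Eventually.of_forall (hle N))
      refine ⟨hmem.toLp _, ?_, ?_⟩
      · filter_upwards [ae_birkhoffSum_congr hν hmem.coeFn_toLp] with x hx n
        rw [hx]
        exact abs_birkhoffSum_cesaro_sub_le L N.succ_pos n x
      · have hb := Lp.norm_le_of_ae_bound (f := hmem.toLp _) (C := shortSup R M L + 2 * D)
          (add_nonneg (shortSup_nonneg _) (by positivity))
          (by filter_upwards [hmem.coeFn_toLp] with x hx; rw [hx]; exact hle N x)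
        simpa [measureUnivNNReal] using hb)
  refine ⟨v, Lp.aestronglyMeasurable v, ?_⟩
  -- The point `v` satisfies the constraint for every `N`; letting `N` tend to infinity reduces the
  -- error to `D`.
  filter_upwards [ae_all_iff.2 hv] with x hx n
  refine ge_of_tendsto' (x := atTop) (f := fun N => c N n) ?_ fun N => hx N n
  have : Tendsto (fun N : ℕ => D * (1 + n / (N + 1 : ℕ))) atTop (𝓝 (D * (1 + 0))) :=
    ((tendsto_const_div_atTop_nhds_zero_nat (n : ℝ)).comp (tendsto_add_atTop_nat 1)
      |>.const_add 1).const_mul D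
  simpa [c] using this

end Potential

end WeakBowen

/-! ### Bounded Birkhoff sums and coboundaries -/

lemma ae_abs_le_norm {X : Type*} [MeasurableSpace X] {ν : Measure X} (φ : Lp ℝ ∞ ν) :
    ∀ᵐ x ∂ν, |φ x| ≤ ‖φ‖ := by
  have h := ae_le_eLpNormEssSup (f := (φ : X → ℝ)) (μ := ν)
  rw [← eLpNorm_exponent_top] at h
  filter_upwards [h] with x hx
  have := ENNReal.toReal_mono (Lp.eLpNorm_ne_top φ) hx
  simpa [Lp.norm_def] using this

/-- The easy half of an `L^∞` version of the Gottschalk-Hedlund theorem: the upper limit of bounded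
Birkhoff sums is a transfer function. -/
lemma exists_eq_sub_of_birkhoffSum_bounded {X : Type*} [MeasurableSpace X] {ν : Measure X}
    {T : X → X} (hT : MeasurePreserving T ν ν) {f : X → ℝ} (hf : Measurable f) {B : ℝ}
    (hB : ∀ᵐ x ∂ν, ∀ n, |birkhoffSum T f n x| ≤ B) :
    ∃ u : X → ℝ, MemLp u ∞ ν ∧ f =ᵐ[ν] fun x => u x - u (T x) := by
  have hm : ∀ n, Measurable fun x => birkhoffSum T f n x := fun n =>
    Finset.measurable_sum _ fun k _ => hf.comp (hT.iterate k).measurable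
  refine ⟨fun x => limsup (fun n => birkhoffSum T f n x) atTop,
    memLp_top_of_bound (Measurable.limsup hm).aestronglyMeasurable B ?_, ?_⟩
  · filter_upwards [hB] with x hx
    have h₁ : IsBoundedUnder (· ≤ ·) atTop fun n => birkhoffSum T f n x :=
      isBoundedUnder_of ⟨B, fun n => (abs_le.1 (hx n)).2⟩
    have h₂ : IsBoundedUnder (· ≥ ·) atTop fun n => birkhoffSum T f n x :=
      isBoundedUnder_of ⟨-B, fun n => (abs_le.1 (hx n)).1⟩
    rw [Real.norm_eq_abs, abs_le]
    exact ⟨le_limsup_of_frequently_le (Frequently.of_forall fun n => (abs_le.1 (hx n)).1) h₁,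
      limsup_le_of_le h₂.isCoboundedUnder_le
        (Eventually.of_forall fun n => (abs_le.1 (hx n)).2)⟩
  · filter_upwards [ae_forall_iterate hT hB] with x hx
    have h₁ : IsBoundedUnder (· ≤ ·) atTop fun n => birkhoffSum T f n (T x) :=
      isBoundedUnder_of ⟨B, fun n => (abs_le.1 (hx 1 n)).2⟩
    have h₂ : IsBoundedUnder (· ≥ ·) atTop fun n => birkhoffSum T f n (T x) :=
      isBoundedUnder_of ⟨-B, fun n => (abs_le.1 (hx 1 n)).1⟩
    -- Take upper limits in `Sₙ₊₁f(x) = f(x) + Sₙf(Tx)`; shifting the index does not change an upper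
    -- limit.
    have h := limsup_const_add atTop (fun n => birkhoffSum T f n (T x)) (f x) h₁
      h₂.isCoboundedUnder_le
    simp only [← birkhoffSum_succ'] at h
    rw [limsup_nat_add (fun n => birkhoffSum T f n x) 1] at h
    rw [h]
    ring

namespace WeakBowen

/-! ### Association of quasimorphisms with weak Bowen functions -/

section Association

variable {d : ℕ} {R : Matrix (Fin d) (Fin d) ℕ} {M : ℕ} {ν : Measure (SFT R)}

lemma isOpen_cylinder (x : SFT R) (n : ℕ) : IsOpen {y : SFT R | ∀ i < n, y.1 i = x.1 i} := by
  have e : {y : SFT R | ∀ i < n, y.1 i = x.1 i} =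
      ⋂ i ∈ Set.Iio n, {y : SFT R | y.1 i = x.1 i} := by
    ext y
    simp
  rw [e]
  refine (Set.finite_Iio n).isOpen_biInter fun i _ => ?_
  have hc : Continuous fun y : SFT R => y.1 i :=
    (continuous_apply i).comp continuous_subtype_val
  exact (isOpen_discrete ({x.1 i} : Set (Fin d))).preimage hc

/-- Cylinders are open. Since full measure sets are dense under full support, this transfers almost
sure statements to every word. -/
lemma exists_mem_initialWord_eq {D : Set (SFT R)} (hD : Dense D) (x : SFT R) (n : ℕ) :
    ∃ y ∈ D, initialWord R y n = initialWord R x n := by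
  obtain ⟨y, hy, hyD⟩ := hD.inter_open_nonempty _ (isOpen_cylinder x n) ⟨x, fun _ _ => rfl⟩
  exact ⟨y, hyD, initialWord_eq_iff.2 hy⟩

lemma coboundaries_le_weakBowen [ν.IsOpenPosMeasure] (hν : MeasurePreserving (shift R) ν ν) :
    coboundaries R ν ≤ weakBowen R ν := by
  rintro φ ⟨u, hu, hφ⟩
  set K := ‖hu.toLp u‖
  have hK : ∀ᵐ x ∂ν, |u x| ≤ K := by
    filter_upwards [ae_abs_le_norm (hu.toLp u), hu.coeFn_toLp] with x h₁ h₂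
    rwa [h₂] at h₁
  have hD := ae_forall_iterate hν hK
  -- Birkhoff sums of the coboundary telescope to size at most `2 * K`, so two of them differ by at
  -- most `4 * K`; the `1` makes the constant positive even if `K = 0`.
  refine ⟨4 * K + 1, {x | ∀ k, |u ((shift R)^[k] x)| ≤ K}, fun x => u x - u (shift R x),
    ⟨Measure.dense_of_ae hD, fun x hx k => hx (k + 1), ⟨2 * K, fun x hx => ?_⟩,
      by positivity, fun n _ x hx y hy _ => ?_⟩, hD, hφ⟩
  · have h₁ := abs_le.1 (hx 0)
    have h₂ := abs_le.1 (hx 1)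
    simp only [Function.iterate_zero, Function.iterate_one, id] at h₁ h₂
    rw [abs_le]
    constructor <;> linarith
  · rw [birkhoffSum_coboundary, birkhoffSum_coboundary]
    have h₁ := abs_le.1 (hx 0)
    have h₂ := abs_le.1 (hx n)
    have h₃ := abs_le.1 (hy 0)
    have h₄ := abs_le.1 (hy n)
    simp only [Function.iterate_zero, id] at h₁ h₃
    rw [abs_le]
    constructor <;> linarith

variable [ν.IsOpenPosMeasure]

/-- The Birkhoff sums of `φ` are uniformly close to the functions `x ↦ L (x₀ ⋯ xₙ₋₁)`. -/
def IsAssociated (L : QM R M) (φ : Bow R ν) : Prop :=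
  ∃ E : ℝ, ∀ᵐ x ∂ν, ∀ n : ℕ, 1 ≤ n →
    |L (initialWord R x n) - birkhoffSum (shift R) φ n x| < E

lemma Bow.norm_def (φ : Bow R ν) :
    ‖φ‖ = bowenConst R ν (Bow.incl R ν φ) + ‖Bow.incl R ν φ‖ := rfl

lemma IsAssociated.lincomb (hν : MeasurePreserving (shift R) ν ν) {L L' : QM R M}
    {φ φ' : Bow R ν} (h : IsAssociated L φ) (h' : IsAssociated L' φ') (a b : ℝ) :
    IsAssociated (a • L + b • L') (a • φ + b • φ') := by
  obtain ⟨E, hE⟩ := h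
  obtain ⟨E', hE'⟩ := h'
  refine ⟨|a| * E + |b| * E' + 1, ?_⟩
  have e : (Bow.incl R ν (a • φ + b • φ') : SFT R → ℝ) =ᵐ[ν]
      a • (Bow.incl R ν φ : SFT R → ℝ) + b • (Bow.incl R ν φ' : SFT R → ℝ) := by
    rw [map_add, map_smul, map_smul]
    exact (Lp.coeFn_add _ _).trans ((Lp.coeFn_smul a _).add (Lp.coeFn_smul b _))
  filter_upwards [hE, hE', ae_birkhoffSum_congr hν e] with x h₁ h₂ h₃ n hn
  rw [h₃, birkhoffSum_lincomb]
  change |a * L (initialWord R x n) + b * L' (initialWord R x n) - _| < _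
  have e' : a * L (initialWord R x n) + b * L' (initialWord R x n) -
      (a * birkhoffSum (shift R) φ n x + b * birkhoffSum (shift R) φ' n x) =
      a * (L (initialWord R x n) - birkhoffSum (shift R) φ n x) +
      b * (L' (initialWord R x n) - birkhoffSum (shift R) φ' n x) := by ring
  rw [e']
  refine (abs_add_le _ _).trans_lt ?_
  rw [abs_mul, abs_mul]
  have h₄ := mul_le_mul_of_nonneg_left (h₁ n hn).le (abs_nonneg a)
  have h₅ := mul_le_mul_of_nonneg_left (h₂ n hn).le (abs_nonneg b)
  linarith

/-- A quasimorphism associated with a coboundary is bounded, and conversely. -/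
lemma IsAssociated.mem_iff [Nonempty (SFT R)] (hν : MeasurePreserving (shift R) ν ν)
    {L : QM R M} {φ : Bow R ν} (h : IsAssociated L φ) :
    L ∈ boundedQM R M ↔ φ ∈ (coboundaries R ν).comap (Bow.incl R ν) := by
  obtain ⟨E, hE⟩ := h
  constructor
  · rintro ⟨C, hC⟩
    have hB : ∀ᵐ x ∂ν, ∀ n, |birkhoffSum (shift R) φ n x| ≤ C + |E| := by
      filter_upwards [hE] with x hx n
      have h₁ := abs_le.1 (hC (initialWord R x n))
      have hE := le_abs_self E
      obtain rfl | hn := n.eq_zero_or_pos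
      · rw [birkhoffSum_zero, abs_zero]
        linarith [abs_nonneg E]
      · have h₂ := abs_lt.1 (hx n hn)
        rw [abs_le]
        constructor <;> linarith
    exact exists_eq_sub_of_birkhoffSum_bounded hν (Lp.stronglyMeasurable _).measurable hB
  · rintro ⟨u, hu, hφ⟩
    set K := ‖hu.toLp u‖
    have hK : ∀ᵐ x ∂ν, |u x| ≤ K := by
      filter_upwards [ae_abs_le_norm (hu.toLp u), hu.coeFn_toLp] with x h₁ h₂
      rwa [h₂] at h₁
    have hae : ∀ᵐ x ∂ν, ∀ n, 1 ≤ n → |L (initialWord R x n)| ≤ 2 * K + E := by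
      filter_upwards [hE, ae_birkhoffSum_congr hν hφ, ae_forall_iterate hν hK]
        with x h₁ h₂ h₃ n hn
      have h₁ := h₁ n hn
      rw [h₂, birkhoffSum_coboundary] at h₁
      have h₁ := abs_lt.1 h₁
      have h₄ := abs_le.1 (h₃ 0)
      have h₅ := abs_le.1 (h₃ n)
      simp only [Function.iterate_zero, id] at h₄
      rw [abs_le]
      constructor <;> linarith
    refine ⟨max (2 * K + E) (defect R L), fun a => ?_⟩
    obtain ⟨x, hx⟩ := exists_initialWord a
    -- Only almost every point satisfies the bound, but one of them begins with the word `a`.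
    obtain ⟨y, hy, hyx⟩ := exists_mem_initialWord_eq (Measure.dense_of_ae hae) x a.1.length
    rw [hx] at hyx
    rw [← hyx]
    obtain h0 | hn := a.1.length.eq_zero_or_pos
    · rw [h0]
      exact (abs_emptyWord_le L y).trans (le_max_right _ _)
    · exact (hy _ hn).trans (le_max_left _ _)

/-- Every quasimorphism has an associated weak Bowen function. -/
theorem exists_isAssociated_left [IsProbabilityMeasure ν] (hν : MeasurePreserving (shift R) ν ν)
    (hM : 0 < M) (L : QM R M) {ε : ℝ} (hε : 0 < ε) :
    ∃ φ : Bow R ν, IsAssociated L φ ∧ ‖φ‖ ≤ 3 * ‖L‖ + ε := by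
  set D := defect R L
  have hD : 0 ≤ D := defect_nonneg _
  obtain ⟨v, hv, h⟩ := exists_birkhoffSum_sub_le hν hM L
  have hbound : ∀ᵐ x ∂ν, ‖v x‖ ≤ shortSup R M L + D := by
    filter_upwards [h] with x hx
    have h₁ := hx 1
    rw [birkhoffSum_one] at h₁
    have h₁ := abs_le.1 h₁
    have h₂ := abs_le.1 (le_shortSup (M := M) L (a := initialWord R x 1)
      (by rw [length_initialWord]; exact hM))
    rw [Real.norm_eq_abs, abs_le]
    constructor <;> linarith
  have hmem : MemLp v ∞ ν := memLp_top_of_bound hv _ hbound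
  let φ : Lp ℝ ∞ ν := hmem.toLp v
  have hφv : φ =ᵐ[ν] v := hmem.coeFn_toLp
  have hφ : ∀ᵐ x ∂ν, ∀ k n, |birkhoffSum (shift R) φ n ((shift R)^[k] x) -
      L (initialWord R ((shift R)^[k] x) n)| ≤ D := by
    refine ae_forall_iterate hν (p := fun x => ∀ n, |birkhoffSum (shift R) φ n x -
      L (initialWord R x n)| ≤ D) ?_
    filter_upwards [h, ae_birkhoffSum_congr hν hφv] with x h₁ h₂ n
    rw [h₂]
    exact h₁ n
  -- Two points with the same first `n` letters are both compared with the same value of `L`, whence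
  -- `2 * D`. The `ε` is needed because Bowen constants are positive while `D` may vanish;
  -- quantifying over `k` makes the domain forward invariant.
  have hconst : HasBowenConst R ν φ (2 * D + ε) := by
    refine ⟨{x | ∀ k n, |birkhoffSum (shift R) φ n ((shift R)^[k] x) -
      L (initialWord R ((shift R)^[k] x) n)| ≤ D}, φ, ⟨Measure.dense_of_ae hφ,
      fun x hx k => hx (k + 1), ⟨shortSup R M L + D, fun x hx => ?_⟩, by positivity,
      fun n _ x hx y hy hxy => ?_⟩, hφ, ae_eq_refl _⟩
    · have h₁ := hx 0 1
      rw [birkhoffSum_one] at h₁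
      have h₁ := abs_le.1 h₁
      have h₂ := abs_le.1 (le_shortSup (M := M) L (a := initialWord R x 1)
        (by rw [length_initialWord]; exact hM))
      simp only [Function.iterate_zero, id] at h₁
      rw [abs_le]
      constructor <;> linarith
    · have h₁ := abs_le.1 (hx 0 n)
      have h₂ := abs_le.1 (hy 0 n)
      simp only [Function.iterate_zero, id, initialWord_eq_iff.2 hxy] at h₁ h₂
      rw [abs_le]
      constructor <;> linarith
  let φ' : Bow R ν := ⟨φ, _, hconst⟩
  refine ⟨φ', ⟨D + 1, ?_⟩, ?_⟩
  · filter_upwards [hφ] with x hx n _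
    rw [abs_sub_comm]
    exact (hx 0 n).trans_lt (by linarith)
  · have h₁ : bowenConst R ν φ ≤ 2 * D + ε := bowenConst_le hconst
    have h₂ : ‖φ‖ ≤ shortSup R M L + D := by
      have hb := Lp.norm_le_of_ae_bound (f := φ) (C := shortSup R M L + D)
        (add_nonneg (shortSup_nonneg _) hD)
        (by filter_upwards [hφv, hbound] with x h₁ h₂; rwa [h₁])
      simpa [measureUnivNNReal] using hb
    have h₃ := shortSup_nonneg (R := R) (M := M) L
    rw [QM.norm_def]
    exact (add_le_add h₁ h₂).trans (by linarith)

/-- Every weak Bowen function is associated with a quasimorphism. -/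
theorem exists_isAssociated_right [Nonempty (SFT R)] (hν : MeasurePreserving (shift R) ν ν)
    (φ : Bow R ν) {ε : ℝ} (hε : 0 < ε) :
    ∃ L : QM R M, IsAssociated L φ ∧ ‖L‖ ≤ (M + 3) * ‖φ‖ + ε := by
  obtain ⟨C, ⟨D, f, hf, hDae, hφf⟩, hC⟩ := exists_lt_of_csInf_lt (s := {C | HasBowenConst R ν
    (Bow.incl R ν φ) C}) φ.2 (lt_add_of_pos_right _ (show 0 < ε / 3 by positivity))
  set K := ‖Bow.incl R ν φ‖
  have hK : 0 ≤ K := norm_nonneg _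
  have hD : ∀ᵐ x ∂ν, x ∈ D ∧ |f x| ≤ K ∧ Bow.incl R ν φ x = f x := by
    filter_upwards [hDae, hφf, ae_abs_le_norm (Bow.incl R ν φ)] with x h₁ h₂ h₃
    exact ⟨h₁, h₂ ▸ h₃, h₂⟩
  have hD' := ae_forall_iterate hν hD
  -- Besides orbits in `D`, the orbit values of `f` must be bounded by the essential norm `K`: this
  -- is what bounds `L` on short words by `M * K`.
  set D' := {x | ∀ k, (shift R)^[k] x ∈ D ∧ |f ((shift R)^[k] x)| ≤ K ∧
    Bow.incl R ν φ ((shift R)^[k] x) = f ((shift R)^[k] x)}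
  have hdense : Dense D' := Measure.dense_of_ae hD'
  have hinv : ∀ x ∈ D', ∀ n, (shift R)^[n] x ∈ D' := fun x hx n k => by
    rw [← Function.iterate_add_apply]
    exact hx (k + n)
  have hpt : ∀ a : Word R, ∃ y ∈ D', initialWord R y a.1.length = a := fun a => by
    obtain ⟨x, hx⟩ := exists_initialWord a
    obtain ⟨y, hy, h⟩ := exists_mem_initialWord_eq hdense x a.1.length
    exact ⟨y, hy, h.trans hx⟩
  choose p hpD hp using hpt
  let L : Word R → ℝ := fun a => birkhoffSum (shift R) f a.1.length (p a)
  have hclose : ∀ x ∈ D', ∀ n,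
      |L (initialWord R x n) - birkhoffSum (shift R) f n x| ≤ C := fun x hx n => by
    have h := hp (initialWord R x n)
    simp only [L, length_initialWord] at h ⊢
    obtain rfl | hn := n.eq_zero_or_pos
    · simpa using hf.pos.le
    · exact hf.bowen n hn _ (hpD _ 0).1 _ (hx 0).1 (initialWord_eq_iff.1 h)
  have hδ : ∀ q, |delta R L q| ≤ 3 * C := defect_le_of_orbit fun x n m => by
    -- The point `x` is arbitrary, so it is replaced by a point of `D'` with the same `n + m`
    -- letters. There the Birkhoff sums are exactly additive, and each of the three words costs `C`.
    obtain ⟨y, hy, hyx⟩ := exists_mem_initialWord_eq hdense x (n + m)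
    have hyx' := initialWord_eq_iff.1 hyx
    have e₁ : initialWord R y n = initialWord R x n :=
      initialWord_eq_iff.2 fun i hi => hyx' i (by omega)
    have e₂ : initialWord R ((shift R)^[n] y) m = initialWord R ((shift R)^[n] x) m :=
      initialWord_eq_iff.2 fun i hi => by
        rw [shift_iterate_apply, shift_iterate_apply]
        exact hyx' _ (by omega)
    rw [← hyx, ← e₁, ← e₂]
    have h₁ := abs_le.1 (hclose y hy (n + m))
    have h₂ := abs_le.1 (hclose y hy n)
    have h₃ := abs_le.1 (hclose _ (hinv y hy n) m)
    rw [birkhoffSum_add] at h₁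
    rw [abs_le]
    constructor <;> linarith
  let L' : QM R M := ⟨L, 3 * C, hδ⟩
  refine ⟨L', ⟨C + 1, ?_⟩, ?_⟩
  · filter_upwards [hD'] with x hx n _
    have e : birkhoffSum (shift R) φ n x = birkhoffSum (shift R) f n x :=
      Finset.sum_congr rfl fun k _ => (hx k).2.2
    rw [e]
    exact (hclose x hx n).trans_lt (by linarith)
  · have h₁ : ‖L'‖ ≤ M * K + 3 * C := QM.norm_le (fun a ha =>
      (abs_birkhoffSum_le (fun k => (hpD a k).2.1) _).trans
        (mul_le_mul_of_nonneg_right (Nat.cast_le.2 ha) hK)) hδ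
    have h₂ : 0 ≤ bowenConst R ν (Bow.incl R ν φ) := Real.sInf_nonneg fun _ h => h.pos.le
    have h₃ : C < bowenConst R ν (Bow.incl R ν φ) + ε / 3 := hC
    have h₄ : 0 ≤ (M : ℝ) * bowenConst R ν (Bow.incl R ν φ) := by positivity
    rw [Bow.norm_def]
    linarith

/-- Two associated pairs have equivalent first entries exactly if the second ones are. -/
lemma IsAssociated.mk_eq_mk_iff [Nonempty (SFT R)] (hν : MeasurePreserving (shift R) ν ν)
    {L L' : QM R M} {φ φ' : Bow R ν} (h : IsAssociated L φ) (h' : IsAssociated L' φ') :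
    (Submodule.Quotient.mk L : QMQuot R M) = Submodule.Quotient.mk L' ↔
      (Submodule.Quotient.mk φ : BowQuot R ν) = Submodule.Quotient.mk φ' := by
  rw [Submodule.Quotient.eq, Submodule.Quotient.eq]
  have := (h.lincomb hν h' 1 (-1)).mem_iff hν
  simpa [← sub_eq_add_neg] using this

/-- Association is invariant under adding coboundaries to the weak Bowen function. -/
lemma IsAssociated.of_mk_eq (hν : MeasurePreserving (shift R) ν ν) {L : QM R M} {φ φ' : Bow R ν}
    (h : IsAssociated L φ)
    (e : (Submodule.Quotient.mk φ : BowQuot R ν) = Submodule.Quotient.mk φ') :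
    IsAssociated L φ' := by
  obtain ⟨u, hu, hφ⟩ := (Submodule.Quotient.eq _).1 e.symm
  have h₀ : IsAssociated (0 : QM R M) (φ' - φ) := by
    set K := ‖hu.toLp u‖
    have hK : ∀ᵐ x ∂ν, |u x| ≤ K := by
      filter_upwards [ae_abs_le_norm (hu.toLp u), hu.coeFn_toLp] with x h₁ h₂
      rwa [h₂] at h₁
    refine ⟨2 * K + 1, ?_⟩
    filter_upwards [ae_birkhoffSum_congr hν hφ, ae_forall_iterate hν hK] with x h₂ h₃ n _
    rw [h₂, birkhoffSum_coboundary]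
    change |0 - _| < _
    have h₄ := abs_le.1 (h₃ 0)
    have h₅ := abs_le.1 (h₃ n)
    simp only [Function.iterate_zero, id] at h₄
    rw [abs_lt]
    constructor <;> linarith
  simpa using h.lincomb hν h₀ 1 1

/-! ### The isomorphism and its bounds -/

variable [IsProbabilityMeasure ν]

/-- The class of the weak Bowen functions associated with a quasimorphism. -/
def potentialClass [Nonempty (SFT R)] (hν : MeasurePreserving (shift R) ν ν) (hM : 0 < M) :
    QM R M →ₗ[ℝ] BowQuot R ν where
  toFun L := Submodule.Quotient.mk (exists_isAssociated_left hν hM L one_pos).choose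
  map_add' L L' := by
    rw [← Submodule.Quotient.mk_add]
    -- Choices of potentials need not be additive, but the chosen potential of `L + L'` and the sum
    -- of the chosen ones are associated with the same quasimorphism, hence cohomologous.
    refine (IsAssociated.mk_eq_mk_iff hν
      (exists_isAssociated_left hν hM (L + L') one_pos).choose_spec.1 (L' := L + L') ?_).1 rfl
    simpa using IsAssociated.lincomb hν (exists_isAssociated_left hν hM L one_pos).choose_spec.1
      (exists_isAssociated_left hν hM L' one_pos).choose_spec.1 1 1
  map_smul' c L := by
    rw [RingHom.id_apply, ← Submodule.Quotient.mk_smul]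
    refine (IsAssociated.mk_eq_mk_iff hν
      (exists_isAssociated_left hν hM (c • L) one_pos).choose_spec.1 (L' := c • L) ?_).1 rfl
    simpa using IsAssociated.lincomb hν (exists_isAssociated_left hν hM L one_pos).choose_spec.1
      (exists_isAssociated_left hν hM L one_pos).choose_spec.1 c 0

lemma potentialClass_eq_mk_iff [Nonempty (SFT R)] (hν : MeasurePreserving (shift R) ν ν)
    (hM : 0 < M) (L : QM R M) (φ : Bow R ν) :
    potentialClass hν hM L = Submodule.Quotient.mk φ ↔ IsAssociated L φ :=
  have h := (exists_isAssociated_left hν hM L one_pos).choose_spec.1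
  ⟨fun e => h.of_mk_eq hν e, fun h' => (h.mk_eq_mk_iff hν h').1 rfl⟩

lemma ker_potentialClass [Nonempty (SFT R)] (hν : MeasurePreserving (shift R) ν ν) (hM : 0 < M) :
    (potentialClass hν hM).ker = boundedQM R M := by
  ext L
  have h := (exists_isAssociated_left hν hM L one_pos).choose_spec.1
  exact (LinearMap.mem_ker.trans (Submodule.Quotient.mk_eq_zero _)).trans (h.mem_iff hν).symm

lemma surjective_potentialClass [Nonempty (SFT R)] (hν : MeasurePreserving (shift R) ν ν)
    (hM : 0 < M) : Function.Surjective (potentialClass hν hM) := by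
  intro ξ
  obtain ⟨φ, rfl⟩ := Submodule.Quotient.mk_surjective _ ξ
  obtain ⟨L, hL, -⟩ := exists_isAssociated_right (M := M) hν φ one_pos
  exact ⟨L, (potentialClass_eq_mk_iff hν hM L φ).2 hL⟩

/-- The isomorphism between quasimorphisms modulo bounded functions and weak Bowen functions modulo
coboundaries, as a linear equivalence. -/
def potentialEquiv [Nonempty (SFT R)] (hν : MeasurePreserving (shift R) ν ν) (hM : 0 < M) :
    QMQuot R M ≃ₗ[ℝ] BowQuot R ν :=
  (Submodule.quotEquivOfEq _ _ (ker_potentialClass hν hM).symm).trans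
    ((potentialClass hν hM).quotKerEquivOfSurjective (surjective_potentialClass hν hM))

lemma potentialEquiv_mk_eq_iff [Nonempty (SFT R)] (hν : MeasurePreserving (shift R) ν ν)
    (hM : 0 < M) (L : QM R M) (φ : Bow R ν) :
    potentialEquiv hν hM (Submodule.Quotient.mk L) = Submodule.Quotient.mk φ ↔
      IsAssociated L φ :=
  potentialClass_eq_mk_iff hν hM L φ

lemma norm_potentialEquiv_le [Nonempty (SFT R)] (hν : MeasurePreserving (shift R) ν ν)
    (hM : 0 < M) (ξ : QMQuot R M) : ‖potentialEquiv (ν := ν) hν hM ξ‖ ≤ 3 * ‖ξ‖ := by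
  refine le_of_forall_pos_le_add fun ε hε => ?_
  obtain ⟨L, rfl, hL⟩ := Submodule.Quotient.norm_mk_lt ξ (show 0 < ε / 6 by positivity)
  -- The class does not depend on the potential, so it may be computed from a nearly optimal one
  -- rather than the one fixed in `potentialClass`.
  obtain ⟨φ, hφ, hle⟩ := exists_isAssociated_left hν hM L (show 0 < ε / 2 by positivity)
  rw [(potentialEquiv_mk_eq_iff hν hM L φ).2 hφ]
  exact (Submodule.Quotient.norm_mk_le _ φ).trans (by linarith)

lemma norm_potentialEquiv_symm_le [Nonempty (SFT R)] (hν : MeasurePreserving (shift R) ν ν)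
    (hM : 0 < M) (ξ : BowQuot R ν) : ‖(potentialEquiv hν hM).symm ξ‖ ≤ (M + 3) * ‖ξ‖ := by
  refine le_of_forall_pos_le_add fun ε hε => ?_
  have hM' : (0 : ℝ) < M + 3 := by positivity
  obtain ⟨φ, rfl, hφ⟩ := Submodule.Quotient.norm_mk_lt ξ (show 0 < ε / (2 * (M + 3)) by positivity)
  obtain ⟨L, hL, hle⟩ := exists_isAssociated_right (M := M) hν φ (show 0 < ε / 2 by positivity)
  rw [← (potentialEquiv_mk_eq_iff hν hM L φ).2 hL, LinearEquiv.symm_apply_apply,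
    (potentialEquiv_mk_eq_iff hν hM L φ).2 hL]
  refine (Submodule.Quotient.norm_mk_le _ L).trans (hle.trans ?_)
  have h := mul_le_mul_of_nonneg_left hφ.le hM'.le
  have e : (M + 3 : ℝ) * (ε / (2 * (M + 3))) = ε / 2 := by field_simp
  rw [mul_add, e] at h
  linarith

end Association

end WeakBowen

end

theorem mainTheorem5 {d : ℕ} (R : Matrix (Fin d) (Fin d) ℕ)
    (hR : ∀ i j, R i j = 0 ∨ R i j = 1)
    (M : ℕ) (hM : 0 < M) (hRM : ∀ i j, 0 < (R ^ M) i j)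
    (ν : Measure (WeakBowen.SFT R)) [IsProbabilityMeasure ν] [ν.IsOpenPosMeasure]
    (hν : MeasurePreserving (WeakBowen.shift R) ν ν) :
    -- every coboundary is a weak Bowen function, and both quotients are Banach spaces
    WeakBowen.coboundaries R ν ≤ WeakBowen.weakBowen R ν ∧
    (∀ ξ : WeakBowen.QMQuot R M, ‖ξ‖ = 0 → ξ = 0) ∧
    CompleteSpace (WeakBowen.QMQuot R M) ∧
    (∀ ξ : WeakBowen.BowQuot R ν, ‖ξ‖ = 0 → ξ = 0) ∧
    CompleteSpace (WeakBowen.BowQuot R ν) ∧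
    -- the isomorphism, and its description: `[L]` goes to `[φ]` exactly if the Birkhoff sums
    -- of `φ` are uniformly close to the functions `x ↦ L (x₀ ⋯ xₙ₋₁)`
    ∃ Γ : WeakBowen.QMQuot R M ≃L[ℝ] WeakBowen.BowQuot R ν,
      ∀ (L : WeakBowen.QM R M) (φ : WeakBowen.Bow R ν),
        Γ (Submodule.Quotient.mk L) = Submodule.Quotient.mk φ ↔
          ∃ E : ℝ, ∀ᵐ x ∂ν, ∀ n : ℕ, 1 ≤ n →
            |L (WeakBowen.initialWord R x n) - birkhoffSum (WeakBowen.shift R) φ n x| < E := by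
  have : Nonempty (WeakBowen.SFT R) := ν.nonempty_of_neZero
  let e := WeakBowen.potentialEquiv (M := M) hν hM
  let Γ : WeakBowen.QMQuot R M ≃L[ℝ] WeakBowen.BowQuot R ν :=
    e.toContinuousLinearEquivOfBounds 3 (M + 3) (WeakBowen.norm_potentialEquiv_le hν hM)
      (WeakBowen.norm_potentialEquiv_symm_le hν hM)
  have hsep : ∀ ξ : WeakBowen.QMQuot R M, ‖ξ‖ = 0 → ξ = 0 := fun ξ hξ => by
    obtain ⟨L, rfl⟩ := Submodule.Quotient.mk_surjective _ ξ
    exact (Submodule.Quotient.mk_eq_zero _).2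
      (WeakBowen.mem_boundedQM_of_norm_mk_eq_zero hR hM hRM hξ)
  -- A quotient of a complete seminormed space is complete; `Γ` carries this over to the weak Bowen
  -- quotient.
  have hQM : CompleteSpace (WeakBowen.QM R M) := WeakBowen.completeSpace_QM hM
  have hcomplete : CompleteSpace (WeakBowen.QMQuot R M) := inferInstance
  refine ⟨WeakBowen.coboundaries_le_weakBowen hν, hsep, hcomplete, fun ξ hξ => ?_,
    (completeSpace_congr (e := Γ.toEquiv) Γ.isUniformEmbedding).1 hcomplete, Γ,
    WeakBowen.potentialEquiv_mk_eq_iff hν hM⟩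
  -- A class of norm zero has a preimage of norm zero, which vanishes by the separation already
  -- shown.
  have h := WeakBowen.norm_potentialEquiv_symm_le (M := M) hν hM ξ
  rw [hξ, mul_zero] at h
  exact e.symm.map_eq_zero_iff.1 (hsep _ (le_antisymm h (norm_nonneg _)))
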